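/- **Setting.** Let $\mathfrak h=\bigoplus_{i=0}^{9}\mathbb C e_i$ with the symmetric $\mathbb C$-bilinear form given by $\langle e_0,e_0\rangle=-1$, $\langle e_j,e_j\rangle=1$ $(1\le j\le 9)$, $\langle e_i,e_j\rangle=0$ $(i\neq j)$. Put $L=\bigoplus_{i=0}^{9}\mathbb Z e_i$, $c=3e_0-e_1-\cdots-e_9$, $\mathfrak h_0=\{\alpha\in\mathfrak h:\langle c,\alpha\rangle=0\}$ and $\overline{\mathfrak h}=\mathfrak h/\mathbb C c$. Let $\alpha_0=e_0-e_1-e_2-e_3$, $\alpha_j=e_j-e_{j+1}$ $(1\le j\le 8)$, $s_j(h)=h-\langle\alpha_j,h\rangle\alpha_j$, $Q(E_8)=\bigoplus_{j=0}^{7}\mathbb Z\alpha_j$, $W(E_8)=\langle s_0,\dots,s_7\rangle\subset W(E_8^{(1)})=\langle s_0,\dots,s_8\rangle\subset GL(\mathfrak h)$. For $\alpha\in\mathfrak h_0$ let $T_\alpha\in GL(\mathfrak h)$ be the Kac translation $$T_\alpha(h)=h+\langle c,h\rangle\alpha-\bigl(\tfrac12\langle\alpha,\alpha\rangle\langle c,h\rangle+\langle\alpha,h\rangle\bigr)c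 ,$$ which depends only on $\alpha$ modulo $\mathbb C c$. Let $G=T(\tfrac12Q(E_8))\rtimes W(E_8)\subset GL(\mathfrak h)$, where $T(\tfrac12Q(E_8))=\{T_\alpha:\alpha\in\tfrac12Q(E_8)\}$; $G$ fixes $c$, so it acts on $\overline{\mathfrak h}$. Let $M=W(E_8^{(1)})\,e_9\subset L$; it contains $e_i$ and $e_0-e_i-e_l$ for distinct $i,l\in\{1,\dots,9\}$, and $T_{\Lambda-e_9}\in G$ for every $\Lambda\in M$. Let $[z]$ be a nonzero entire function such that, with $[x\pm y]=[x+y][x-y]$, $$[\beta\pm\gamma][z\pm\alpha]+[\gamma\pm\alpha][z\pm\beta]+[\alpha\pm\beta][z\pm\gamma]=0\qquad(z,\alpha,\beta,\gamma\in\mathbb C).$$ Let $X$ be a set with a left action of $G$ and $\gamma:X\to\overline{\mathfrak h}$ a $G$-equivariant map. For $\alpha\in\mathfrak h_0$ let $\sigma_\alpha$ be the function $\sigma_\alpha(x)=[\langle\alpha,\gamma(x)\rangle]$ on $X$, and write $\sigma_{\alpha\pm\beta}=\sigma_{\alpha+\beta}\sigma_{\alpha-\beta}$. For $w\in G$ and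 $\varphi:X\to\mathbb C$ let $(w.\varphi)(x)=\varphi(w^{-1}.x)$. Write $e_{ij}=e_i-e_j$ and $e_{ijk}=e_0-e_i-e_j-e_k$. **Proposition.** Let $\tau:X\to\mathbb C$ be a $W(E_8)$-invariant function and set $\tau_\Lambda=T_{\Lambda-e_9}^{-1}.\tau$ for each $\Lambda\in M$. Then the following three conditions are equivalent (all equations being identities of functions on $X$). (a) For all mutually distinct $i,j,k,l\in\{1,\dots,9\}$, $$\sigma_{e_{jk}}\sigma_{e_{jkl}}\tau_{e_i}\tau_{e_0-e_i-e_l}+\sigma_{e_{ki}}\sigma_{e_{kil}}\tau_{e_j}\tau_{e_0-e_j-e_l}+\sigma_{e_{ij}}\sigma_{e_{ijl}}\tau_{e_k}\tau_{e_0-e_k-e_l}=0 .$$ (b) For all $u_i,u_i'\in M$ $(i=0,1,2)$ with $u_0+u_0'=u_1+u_1'=u_2+u_2'$ and $\langle u_i-u_i',u_j-u_j'\rangle=4\delta_{ij}$ $(i,j=0,1,2)$, $$\sigma_{u_1-u_2}\sigma_{u_1-u_2'}\tau_{u_0}\tau_{u_0'}+\sigma_{u_2-u_0}\sigma_{u_2-u_0'}\tau_{u_1}\tau_{u_1'}+\sigma_{u_0-u_1}\sigma_{u_0-u_1'}\tau_{u_2}\tau_{u_2'}=0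 .$$ (c) For all $a_0,a_1,a_2\in\tfrac12Q(E_8)$ with $\langle a_i,a_j\rangle=\delta_{ij}$ and $\pm a_i\pm a_j\in Q(E_8)$ $(i,j=0,1,2)$, i.e. for every $C_3$-frame $\{\pm a_0,\pm a_1,\pm a_2\}$ of $Q(E_8)$, $$\sigma_{a_1\pm a_2}\,(T_{a_0}.\tau)(T_{a_0}^{-1}.\tau)+\sigma_{a_2\pm a_0}\,(T_{a_1}.\tau)(T_{a_1}^{-1}.\tau)+\sigma_{a_0\pm a_1}\,(T_{a_2}.\tau)(T_{a_2}^{-1}.\tau)=0 .$$ -/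

import Mathlib

noncomputable section

namespace NinePoints

/-! ### The Picard lattice and the affine root system of type `E₈⁽¹⁾` -/

/-- The complex vector space `𝔥 = ℂ e₀ ⊕ ℂ e₁ ⊕ ⋯ ⊕ ℂ e₉`. -/
abbrev H : Type := Fin 10 → ℂ

/-- The basis vector `e_i`, `i = 0, …, 9`. -/
def e (i : Fin 10) : H := Pi.single i 1

/-- The scalar product with `⟨e₀,e₀⟩ = -1`, `⟨e_j,e_j⟩ = 1` for `j = 1, …, 9`, and
`⟨e_i,e_j⟩ = 0` for `i ≠ j`. -/
def ipr : H →ₗ[ℂ] H →ₗ[ℂ] ℂ :=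
  LinearMap.mk₂ ℂ (fun x y => -(x 0 * y 0) + ∑ j : Fin 9, x j.succ * y j.succ)
    (by intro x x' y; simp [add_mul, Finset.sum_add_distrib]; ring)
    (by intro a x y; simp [mul_assoc, mul_add, Finset.mul_sum])
    (by intro x y y'; simp [mul_add, Finset.sum_add_distrib]; ring)
    (by intro a x y; simp [mul_left_comm, mul_add, Finset.mul_sum])

theorem ipr_apply (x y : H) :
    ipr x y = -(x 0 * y 0) + ∑ j : Fin 9, x j.succ * y j.succ := rfl

theorem ipr_comm (x y : H) : ipr x y = ipr y x := by
  simp [ipr_apply, mul_comm]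

/-- The vector `c = 3 e₀ - e₁ - ⋯ - e₉`. -/
def c : H := (3 : ℂ) • e 0 - ∑ j : Fin 9, e j.succ

/-- The Picard lattice `L = ℤ e₀ ⊕ ⋯ ⊕ ℤ e₉`. -/
def L : AddSubgroup H := AddSubgroup.closure (Set.range e)

/-- The simple roots `α₀ = e₀ - e₁ - e₂ - e₃` and `α_j = e_j - e_{j+1}`, `j = 1, …, 8`. -/
def simpleRoot (j : Fin 9) : H :=
  if j = 0 then e 0 - e 1 - e 2 - e 3 else e j.castSucc - e j.succ

/-- The root lattice `Q(E₈) = ℤ α₀ ⊕ ⋯ ⊕ ℤ α₇`. -/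
def QE8 : AddSubgroup H := AddSubgroup.closure (Set.range fun j : Fin 8 => simpleRoot j.castSucc)

/-- The lattice `½ Q(E₈)`. -/
def halfQE8 : AddSubgroup H where
  carrier := {a | a + a ∈ QE8}
  zero_mem' := by simp
  add_mem' := by
    intro a b ha hb
    have h : (a + b) + (a + b) = (a + a) + (b + b) := by abel
    show (a + b) + (a + b) ∈ QE8
    rw [h]
    exact add_mem ha hb
  neg_mem' := by
    intro a ha
    have h : -a + -a = -(a + a) := by abel
    show -a + -a ∈ QE8
    rw [h]
    exact neg_mem ha

theorem e_apply (i j : Fin 10) : e i j = if j = i then 1 else 0 := Pi.single_apply i 1 j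

theorem ipr_e (i j : Fin 10) :
    ipr (e i) (e j) = if i = j then (if i = 0 then -1 else 1) else 0 := by
  refine Fin.cases ?_ (fun i => ?_) i <;> refine Fin.cases ?_ (fun j => ?_) j <;>
    simp [ipr_apply, e_apply, eq_comm, Fin.succ_ne_zero]

theorem ipr_simpleRoot_self (j : Fin 9) : ipr (simpleRoot j) (simpleRoot j) = 2 := by
  by_cases h : j = 0
  · subst h
    simp [simpleRoot, ipr_e]
    norm_num
  · have h1 : j.castSucc ≠ 0 := by simpa using h
    have h2 : j.castSucc ≠ j.succ := Fin.castSucc_lt_succ.ne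
    simp [simpleRoot, h, ipr_e, h2, h2.symm, Fin.succ_ne_zero]
    norm_num

theorem ipr_c_e_zero : ipr c (e 0) = -3 := by
  simp [c, ipr_e, Fin.succ_ne_zero]

theorem ipr_c_e_succ (i : Fin 9) : ipr c (e i.succ) = -1 := by
  simp [c, ipr_e, Fin.succ_ne_zero, (Fin.succ_ne_zero _).symm]

theorem ipr_c_simpleRoot (j : Fin 9) : ipr c (simpleRoot j) = 0 := by
  by_cases h : j = 0
  · subst h
    have h1 := ipr_c_e_succ 0
    have h2 := ipr_c_e_succ 1
    have h3 := ipr_c_e_succ 2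
    simp only [Fin.reduceSucc, Fin.succ_zero_eq_one, Fin.succ_one_eq_two] at h1 h2 h3
    simp [simpleRoot, ipr_c_e_zero, h1, h2, h3]
    norm_num
  · obtain ⟨i, rfl⟩ := Fin.exists_succ_eq.2 h
    rw [simpleRoot, if_neg h, ← Fin.succ_castSucc, map_sub, ipr_c_e_succ, ipr_c_e_succ, sub_self]

theorem ipr_c_c : ipr c c = 0 := by
  have h : ipr c c = ipr c ((3 : ℂ) • e 0 - ∑ j : Fin 9, e j.succ) := rfl
  rw [h, map_sub, map_smul, map_sum]
  simp [ipr_c_e_zero, ipr_c_e_succ]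
  norm_num

/-- The subspace `𝔥₀ = {α ∈ 𝔥 | ⟨c, α⟩ = 0}`. -/
def H0 : Submodule ℂ H := LinearMap.ker (ipr c)

theorem mem_H0 {a : H} : a ∈ H0 ↔ ipr c a = 0 := LinearMap.mem_ker

theorem QE8_le_H0 {a : H} (ha : a ∈ QE8) : a ∈ H0 := by
  have h : QE8 ≤ H0.toAddSubgroup := by
    refine (AddSubgroup.closure_le _).2 ?_
    rintro _ ⟨j, rfl⟩
    exact mem_H0.2 (ipr_c_simpleRoot _)
  exact h ha

theorem halfQE8_le_H0 {a : H} (ha : a ∈ halfQE8) : a ∈ H0 := by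
  have h : a + a ∈ H0 := QE8_le_H0 ha
  rw [mem_H0, map_add] at h
  rw [mem_H0]
  linear_combination h / 2

/-! ### Reflections, Kac translations and Weyl groups -/

/-- The simple reflection `s_j(h) = h - ⟨α_j, h⟩ α_j` (recall `⟨α_j, α_j⟩ = 2`). -/
def s (j : Fin 9) : H ≃ₗ[ℂ] H :=
  Module.reflection (x := simpleRoot j) (f := ipr (simpleRoot j)) (ipr_simpleRoot_self j)

theorem s_apply (j : Fin 9) (v : H) : s j v = v - ipr (simpleRoot j) v • simpleRoot j := rfl

theorem s_s (j : Fin 9) (v : H) : s j (s j v) = v := Module.involutive_reflection _ v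

/-- The Weyl group `W(E₈) = ⟨s₀, …, s₇⟩`. -/
def weylE8 : Subgroup (H ≃ₗ[ℂ] H) := Subgroup.closure (Set.range fun j : Fin 8 => s j.castSucc)

/-- The affine Weyl group `W(E₈⁽¹⁾) = ⟨s₀, …, s₈⟩`. -/
def affineWeylE8 : Subgroup (H ≃ₗ[ℂ] H) := Subgroup.closure (Set.range s)

/-- The map `h ↦ h + ⟨c,h⟩ α - (½⟨α,α⟩⟨c,h⟩ + ⟨α,h⟩) c`. -/
def kacLin (a : H) : H →ₗ[ℂ] H where
  toFun h := h + ipr c h • a - ((1 / 2 : ℂ) * ipr a a * ipr c h + ipr a h) • c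
  map_add' x y := by
    ext i
    simp
    ring
  map_smul' t x := by
    ext i
    simp
    ring

theorem kacLin_apply (a h : H) :
    kacLin a h = h + ipr c h • a - ((1 / 2 : ℂ) * ipr a a * ipr c h + ipr a h) • c := rfl

theorem kacLin_kacLin {a b : H} (ha : a ∈ H0) (hb : b ∈ H0) (h : H) :
    kacLin a (kacLin b h) = kacLin (a + b) h := by
  rw [mem_H0] at ha hb
  have ha' : ipr a c = 0 := by rw [ipr_comm]; exact ha
  have hab : ipr b a = ipr a b := ipr_comm b a
  ext i
  simp [kacLin_apply, hb, ha', hab, ipr_c_c]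
  ring

theorem kacLin_zero (h : H) : kacLin 0 h = h := by simp [kacLin_apply]

/-- The Kac translation `T_α`, `α ∈ 𝔥₀`, as an element of `GL(𝔥)`. -/
def kac (a : H0) : H ≃ₗ[ℂ] H :=
  LinearEquiv.ofLinearMap (kacLin a) (kacLin (-a : H0))
    (by
      ext1 i
      ext1
      simp only [LinearMap.comp_apply, LinearMap.id_apply]
      rw [kacLin_kacLin a.2 (-a).2]
      simp [kacLin_zero])
    (by
      ext1 i
      ext1
      simp only [LinearMap.comp_apply, LinearMap.id_apply]
      rw [kacLin_kacLin (-a).2 a.2]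
      simp [kacLin_zero])

theorem kac_apply (a : H0) (h : H) :
    kac a h = h + ipr c h • (a : H)
      - ((1 / 2 : ℂ) * ipr (a : H) a * ipr c h + ipr (a : H) h) • c := rfl

theorem kac_mul (a b : H0) : kac a * kac b = kac (a + b) := by
  ext1 h
  exact kacLin_kacLin a.2 b.2 h

theorem kac_zero : kac 0 = 1 := by
  ext1 h
  exact kacLin_zero h

theorem kac_neg (a : H0) : kac (-a) = (kac a)⁻¹ := by
  rw [eq_inv_iff_mul_eq_one, kac_mul, neg_add_cancel, kac_zero]

/-- `T_{α + k c} = T_α`. -/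
theorem kac_eq_of_sub {a b : H0} {k : ℂ} (h : (a : H) = b + k • c) : kac a = kac b := by
  have hb : ipr c b = 0 := mem_H0.1 b.2
  have hb' : ipr (b : H) c = 0 := by rw [ipr_comm]; exact hb
  ext1 v
  rw [kac_apply, kac_apply, h]
  ext i
  simp [hb, hb', ipr_c_c]
  ring

/-- For an additive subgroup `Q`, the group `T(Q)` of Kac translations `T_α`, `α ∈ Q ∩ 𝔥₀`. -/
def kacSubgroup (Q : AddSubgroup H) : Subgroup (H ≃ₗ[ℂ] H) where
  carrier := {g | ∃ a : H0, (a : H) ∈ Q ∧ kac a = g}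
  one_mem' := ⟨0, by simp, kac_zero⟩
  mul_mem' := by
    rintro _ _ ⟨a, ha, rfl⟩ ⟨b, hb, rfl⟩
    exact ⟨a + b, add_mem ha hb, (kac_mul a b).symm⟩
  inv_mem' := by
    rintro _ ⟨a, ha, rfl⟩
    exact ⟨-a, neg_mem ha, kac_neg a⟩

/-- The extended group `T(½ Q(E₈)) ⋊ W(E₈) ⊂ GL(𝔥)`, as the subgroup generated by its two
factors. -/
def G : Subgroup (H ≃ₗ[ℂ] H) := kacSubgroup halfQE8 ⊔ weylE8

theorem G_apply_c {g : H ≃ₗ[ℂ] H} (hg : g ∈ G) : g c = c := by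
  have h : G ≤ MulAction.stabilizer (H ≃ₗ[ℂ] H) c := by
    refine sup_le ?_ ?_
    · rintro _ ⟨a, -, rfl⟩
      have ha : ipr (a : H) c = 0 := by rw [ipr_comm]; exact mem_H0.1 a.2
      rw [MulAction.mem_stabilizer_iff]
      show kac a c = c
      rw [kac_apply]
      simp [ha, ipr_c_c]
    · refine (Subgroup.closure_le _).2 ?_
      rintro _ ⟨j, rfl⟩
      show s j.castSucc c = c
      rw [s_apply, ipr_comm, ipr_c_simpleRoot]
      simp
  exact h hg

/-! ### The quotient `𝔥 / ℂ c` -/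

/-- The quotient `𝔥 / ℂ c`. -/
abbrev Hbar : Type := H ⧸ Submodule.span ℂ {c}

/-- The action of `T(½ Q(E₈)) ⋊ W(E₈)` on `𝔥 / ℂ c` induced by its linear action on `𝔥`. -/
def actBar (g : G) : Hbar →ₗ[ℂ] Hbar :=
  Submodule.mapQ _ _ (g : H ≃ₗ[ℂ] H).toLinearMap (by
    rw [Submodule.span_singleton_le_iff_mem, Submodule.mem_comap]
    show (g : H ≃ₗ[ℂ] H) c ∈ _
    rw [G_apply_c g.2]
    exact Submodule.mem_span_singleton_self c)

theorem actBar_mk (g : G) (h : H) :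
    actBar g (Submodule.Quotient.mk h) = Submodule.Quotient.mk ((g : H ≃ₗ[ℂ] H) h) := rfl

/-- The linear function `⟨α, ·⟩` on `𝔥 / ℂ c` for `α ∈ 𝔥₀`. -/
def pairBar (a : H0) : Hbar →ₗ[ℂ] ℂ :=
  Submodule.liftQ _ (ipr (a : H)) (by
    rw [Submodule.span_singleton_le_iff_mem, LinearMap.mem_ker, ipr_comm]
    exact mem_H0.1 a.2)

theorem pairBar_mk (a : H0) (h : H) :
    pairBar a (Submodule.Quotient.mk h) = ipr (a : H) h := rfl

/-! ### The orbit `M` -/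

/-- The orbit `M = W(E₈⁽¹⁾) e₉`. -/
def M : Set H := {v | ∃ w ∈ affineWeylE8, v = w (e 9)}

theorem s_mem_M (j : Fin 9) {v : H} (hv : v ∈ M) : s j v ∈ M := by
  obtain ⟨w, hw, rfl⟩ := hv
  exact ⟨s j * w, mul_mem (Subgroup.subset_closure ⟨j, rfl⟩) hw, rfl⟩

theorem simpleRoot_mem_L (j : Fin 9) : simpleRoot j ∈ L := by
  have h : ∀ i, e i ∈ L := fun i => AddSubgroup.subset_closure ⟨i, rfl⟩
  unfold simpleRoot
  split_ifs
  · exact sub_mem (sub_mem (sub_mem (h _) (h _)) (h _)) (h _)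
  · exact sub_mem (h _) (h _)

theorem ipr_L_int {u v : H} (hu : u ∈ L) (hv : v ∈ L) : ∃ n : ℤ, ipr u v = n := by
  have key : ∀ v ∈ L, ∀ i, ∃ n : ℤ, v i = n := by
    intro v hv
    induction hv using AddSubgroup.closure_induction with
    | mem x hx =>
      obtain ⟨j, rfl⟩ := hx
      intro i
      by_cases h : i = j
      · exact ⟨1, by simp [e, h]⟩
      · exact ⟨0, by simp [e, h]⟩
    | zero => intro i; exact ⟨0, by simp⟩
    | add x y _ _ hx hy =>
      intro i
      obtain ⟨m, hm⟩ := hx i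
      obtain ⟨n, hn⟩ := hy i
      exact ⟨m + n, by simp [hm, hn]⟩
    | neg x _ hx =>
      intro i
      obtain ⟨m, hm⟩ := hx i
      exact ⟨-m, by simp [hm]⟩
  choose m hm using key u hu
  choose n hn using key v hv
  refine ⟨-(m 0 * n 0) + ∑ j : Fin 9, m j.succ * n j.succ, ?_⟩
  rw [ipr_apply]
  push_cast
  simp only [hm, hn]

/-- Each simple root of type `E₈⁽¹⁾` is congruent modulo `ℤ c` to an element of `Q(E₈)`. -/
theorem simpleRoot_mod_c (j : Fin 9) : ∃ q ∈ QE8, ∃ k : ℤ, simpleRoot j = q + (k : ℂ) • c := by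
  have hm : ∀ i : Fin 8, simpleRoot i.castSucc ∈ QE8 :=
    fun i => AddSubgroup.subset_closure ⟨i, rfl⟩
  by_cases h : j = 8
  · subst h
    refine ⟨-((3 : ℤ) • simpleRoot (0 : Fin 8).castSucc + (2 : ℤ) • simpleRoot (1 : Fin 8).castSucc
      + (4 : ℤ) • simpleRoot (2 : Fin 8).castSucc + (6 : ℤ) • simpleRoot (3 : Fin 8).castSucc
      + (5 : ℤ) • simpleRoot (4 : Fin 8).castSucc + (4 : ℤ) • simpleRoot (5 : Fin 8).castSucc
      + (3 : ℤ) • simpleRoot (6 : Fin 8).castSucc + (2 : ℤ) • simpleRoot (7 : Fin 8).castSucc),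
      neg_mem (add_mem (add_mem (add_mem (add_mem (add_mem (add_mem (add_mem
        (zsmul_mem (hm _) _) (zsmul_mem (hm _) _)) (zsmul_mem (hm _) _)) (zsmul_mem (hm _) _))
        (zsmul_mem (hm _) _)) (zsmul_mem (hm _) _)) (zsmul_mem (hm _) _)) (zsmul_mem (hm _) _)),
      1, ?_⟩
    ext i
    fin_cases i <;>
      simp [simpleRoot, e, c, Fin.sum_univ_succ, Fin.ext_iff] <;> norm_num
  · obtain ⟨i, rfl⟩ := Fin.exists_castSucc_eq.2 (show j ≠ Fin.last 8 from h)
    exact ⟨_, hm i, 0, by simp⟩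

theorem M_mod_c {v : H} (hv : v ∈ M) : v ∈ L ∧ ∃ q ∈ QE8, ∃ k : ℤ, v - e 9 = q + (k : ℂ) • c := by
  let S : Set H := {v | v ∈ L ∧ ∃ q ∈ QE8, ∃ k : ℤ, v - e 9 = q + (k : ℂ) • c}
  have hs : ∀ j, ∀ v ∈ S, s j v ∈ S := by
    rintro j v ⟨hL, q, hq, k, hk⟩
    obtain ⟨n, hn⟩ := ipr_L_int (simpleRoot_mem_L j) hL
    obtain ⟨q', hq', k', hk'⟩ := simpleRoot_mod_c j
    have e1 : s j v = v - n • simpleRoot j := by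
      rw [s_apply, hn, Int.cast_smul_eq_zsmul]
    refine ⟨?_, q - n • q', sub_mem hq (zsmul_mem hq' n), k - n * k', ?_⟩
    · rw [e1]
      exact sub_mem hL (zsmul_mem (simpleRoot_mem_L j) n)
    · rw [e1, sub_right_comm, hk, hk']
      ext i
      simp
      ring
  have hw : ∀ w ∈ affineWeylE8, ∀ v, v ∈ S ↔ w v ∈ S := by
    intro w hw
    induction hw using Subgroup.closure_induction with
    | mem x hx =>
      obtain ⟨j, rfl⟩ := hx
      intro v
      refine ⟨hs j v, fun h => ?_⟩
      have := hs j _ h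
      rwa [s_s] at this
    | one => intro v; rfl
    | mul x y _ _ hx hy => intro v; exact (hy v).trans (hx (y v))
    | inv x _ hx =>
      intro v
      have h1 : x (x⁻¹ v) = v := x.apply_symm_apply v
      have h2 := hx (x⁻¹ v)
      rw [h1] at h2
      exact h2.symm
  obtain ⟨w, hw', rfl⟩ := hv
  exact (hw w hw' (e 9)).1
    ⟨AddSubgroup.subset_closure ⟨9, rfl⟩, 0, zero_mem _, 0, by simp⟩

theorem M_sub_mem_H0 {u v : H} (hu : u ∈ M) (hv : v ∈ M) : u - v ∈ H0 := by
  have key : ∀ {v : H}, v ∈ M → ipr c (v - e 9) = 0 := by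
    intro v hv
    obtain ⟨-, q, hq, k, hk⟩ := M_mod_c hv
    rw [hk, map_add, map_smul, ipr_c_c, mem_H0.1 (QE8_le_H0 hq)]
    simp
  have h : u - v = (u - e 9) - (v - e 9) := by abel
  rw [mem_H0, h, map_sub, key hu, key hv, sub_zero]

theorem e9_mem_M : e 9 ∈ M := ⟨1, one_mem _, rfl⟩

/-- The permutations of `e₁, …, e₉` are realized by elements of the affine Weyl group. -/
theorem exists_perm (p : Equiv.Perm (Fin 9)) :
    ∃ w ∈ affineWeylE8, w (e 0) = e 0 ∧ ∀ i : Fin 9, w (e i.succ) = e (p i).succ := by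
  have hp : p ∈ Submonoid.closure
      (Set.range fun i : Fin 8 => Equiv.swap i.castSucc i.succ) := by
    rw [Equiv.Perm.mclosure_swap_castSucc_succ]
    trivial
  induction hp using Submonoid.closure_induction with
  | mem x hx =>
    obtain ⟨j, rfl⟩ := hx
    refine ⟨s j.succ, Subgroup.subset_closure ⟨_, rfl⟩, ?_, ?_⟩
    · rw [s_apply]
      have : ipr (simpleRoot j.succ) (e 0) = 0 := by
        simp [simpleRoot, ipr_e, Fin.succ_ne_zero]
      rw [this]
      simp
    · intro i
      rw [s_apply]
      have h1 : simpleRoot j.succ = e j.castSucc.succ - e j.succ.succ := by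
        simp [simpleRoot, Fin.castSucc_succ]
      have h2 : ∀ a b : Fin 9, ipr (e a.succ) (e b.succ) = if a = b then 1 else 0 := by
        intro a b
        simp [ipr_apply, e, Pi.single_apply, eq_comm]
      simp only [h1, map_sub, LinearMap.sub_apply, h2]
      have hne : j.castSucc ≠ j.succ := Fin.castSucc_lt_succ.ne
      by_cases ha : i = j.castSucc
      · subst ha
        simp [hne.symm]
      · by_cases hb : i = j.succ
        · subst hb
          simp [hne]
        · rw [Equiv.swap_apply_of_ne_of_ne ha hb]
          simp [Ne.symm ha, Ne.symm hb]
  | one => exact ⟨1, one_mem _, rfl, fun _ => rfl⟩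
  | mul x y _ _ hx hy =>
    obtain ⟨w, hw, h0, h1⟩ := hx
    obtain ⟨w', hw', h0', h1'⟩ := hy
    refine ⟨w * w', mul_mem hw hw', ?_, ?_⟩
    · rw [LinearEquiv.mul_apply, h0', h0]
    · intro i
      rw [LinearEquiv.mul_apply, h1', h1]
      rfl

theorem apply_mem_M {w : H ≃ₗ[ℂ] H} (hw : w ∈ affineWeylE8) {v : H} (hv : v ∈ M) : w v ∈ M := by
  obtain ⟨w', hw', rfl⟩ := hv
  exact ⟨w * w', mul_mem hw hw', rfl⟩

/-- `e_i ∈ M` for `i = 1, …, 9`; the index `i : Fin 9` stands for `i + 1`. -/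
theorem e_mem_M (i : Fin 9) : e i.succ ∈ M := by
  obtain ⟨w, hw, -, h⟩ := exists_perm (Equiv.swap 8 i)
  have h8 := h 8
  rw [Equiv.swap_apply_left] at h8
  rw [← h8]
  exact apply_mem_M hw e9_mem_M

/-- `e₀ - e_i - e_l ∈ M` for distinct `i, l ∈ {1, …, 9}`. -/
theorem line_mem_M {i l : Fin 9} (hil : i ≠ l) : e 0 - e i.succ - e l.succ ∈ M := by
  have h0 : e 0 - e (1 : Fin 9).succ - e (2 : Fin 9).succ ∈ M := by
    have h : s 0 (e (0 : Fin 9).succ) = e 0 - e (1 : Fin 9).succ - e (2 : Fin 9).succ := by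
      have h1 : ipr (simpleRoot 0) (e (0 : Fin 9).succ) = -1 := by
        simp [simpleRoot, ipr_e]
      rw [s_apply, h1]
      simp [simpleRoot]
      abel
    rw [← h]
    exact s_mem_M 0 (e_mem_M 0)
  obtain ⟨w, hw, hw0, h⟩ := exists_perm
    (Equiv.swap (Equiv.swap 1 i 2) l * Equiv.swap 1 i)
  have h1 : (Equiv.swap (Equiv.swap 1 i 2) l * Equiv.swap 1 i) 1 = i := by
    rw [Equiv.Perm.mul_apply, Equiv.swap_apply_left, Equiv.swap_apply_of_ne_of_ne _ hil]
    intro h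
    have := (Equiv.swap (1 : Fin 9) i).injective ((Equiv.swap_apply_left 1 i).trans h)
    exact absurd this (by decide)
  have h2 : (Equiv.swap (Equiv.swap 1 i 2) l * Equiv.swap 1 i) 2 = l := by
    rw [Equiv.Perm.mul_apply, Equiv.swap_apply_left]
  have h3 := apply_mem_M hw h0
  rw [map_sub, map_sub, hw0, h, h, h1, h2] at h3
  exact h3

/-- `e_i` as a point of `M`. -/
def eM (i : Fin 9) : M := ⟨e i.succ, e_mem_M i⟩

/-- `e₀ - e_i - e_l` as a point of `M`. -/
def lineM (i l : Fin 9) (hil : i ≠ l) : M := ⟨e 0 - e i.succ - e l.succ, line_mem_M hil⟩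

/-- The difference `u - v ∈ 𝔥₀` of two points of `M`. -/
def diffM (u v : M) : H0 := ⟨(u : H) - v, M_sub_mem_H0 u.2 v.2⟩

/-- `e_{ij} = e_i - e_j ∈ 𝔥₀`. -/
def e2 (i j : Fin 9) : H0 :=
  ⟨e i.succ - e j.succ, by rw [mem_H0, map_sub, ipr_c_e_succ, ipr_c_e_succ, sub_self]⟩

/-- `e_{ijk} = e₀ - e_i - e_j - e_k ∈ 𝔥₀`. -/
def e3 (i j k : Fin 9) : H0 :=
  ⟨e 0 - e i.succ - e j.succ - e k.succ, by
    rw [mem_H0, map_sub, map_sub, map_sub, ipr_c_e_zero, ipr_c_e_succ, ipr_c_e_succ, ipr_c_e_succ]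
    norm_num⟩

/-! ### Translations and Weyl group elements as elements of the acting group -/

theorem kac_mem_G {a : H0} (ha : (a : H) ∈ halfQE8) : kac a ∈ G :=
  (le_sup_left : kacSubgroup halfQE8 ≤ G) ⟨a, ha, rfl⟩

theorem kac_M_mem_G (u : M) : kac (diffM u ⟨e 9, e9_mem_M⟩) ∈ G := by
  obtain ⟨-, q, hq, k, hk⟩ := M_mod_c u.2
  have h : kac (diffM u ⟨e 9, e9_mem_M⟩) = kac ⟨q, QE8_le_H0 hq⟩ := kac_eq_of_sub hk
  rw [h]
  exact kac_mem_G (add_mem hq hq)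

/-- The translation `T_a`, `a ∈ ½ Q(E₈)`, as an element of `T(½ Q(E₈)) ⋊ W(E₈)`. -/
def T (a : halfQE8) : G := ⟨kac ⟨a, halfQE8_le_H0 a.2⟩, kac_mem_G a.2⟩

/-- The translation `T_{Λ - e₉}`, `Λ ∈ M`, as an element of `T(½ Q(E₈)) ⋊ W(E₈)`; it belongs to
this group because it equals `T_α`, where `α ∈ Q(E₈)` is the classical part of `Λ - e₉`. -/
def TM (u : M) : G := ⟨kac (diffM u ⟨e 9, e9_mem_M⟩), kac_M_mem_G u⟩

/-- The vector `a ∈ ½ Q(E₈)` as an element of `𝔥₀`. -/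
def toH0 (a : halfQE8) : H0 := ⟨a, halfQE8_le_H0 a.2⟩

/-! ### Functions on a set with an action -/

/-- A nonzero entire function `[z]` satisfying the three-term relation. -/
structure IsBracket (br : ℂ → ℂ) : Prop where
  differentiable : Differentiable ℂ br
  ne_zero : br ≠ 0
  three_term : ∀ z α β γ : ℂ,
    br (β + γ) * br (β - γ) * (br (z + α) * br (z - α))
      + br (γ + α) * br (γ - α) * (br (z + β) * br (z - β))
      + br (α + β) * br (α - β) * (br (z + γ) * br (z - γ)) = 0

section Functions

variable {X : Type*} [MulAction G X]

/-- The action of the group on functions, `(w.φ)(x) = φ(w⁻¹.x)`. -/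
def actFun (g : G) (f : X → ℂ) : X → ℂ := fun x => f (g⁻¹ • x)

/-- Equivariance of `γ : X → 𝔥 / ℂ c`. -/
def IsEquivariant (γ : X → Hbar) : Prop := ∀ (g : G) (x : X), γ (g • x) = actBar g (γ x)

/-- `W(E₈)`-invariance of a function on `X`. -/
def IsWeylInvariant (τ : X → ℂ) : Prop := ∀ g : G, (g : H ≃ₗ[ℂ] H) ∈ weylE8 → actFun g τ = τ

/-- The function `σ_α = [⟨α, ·⟩]` on `X`, `α ∈ 𝔥₀`. -/
def sigma (br : ℂ → ℂ) (γ : X → Hbar) (a : H0) : X → ℂ := fun x => br (pairBar a (γ x))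

/-- `τ_Λ = T_{Λ - e₉}⁻¹.τ` for `Λ ∈ M`. -/
def latticeTau (τ : X → ℂ) (u : M) : X → ℂ := actFun (TM u)⁻¹ τ

/-- Condition (a): the quadratic relations for quadruples of distinct indices in `{1, …, 9}`. -/
def NinePointRelations (br : ℂ → ℂ) (γ : X → Hbar) (τ : X → ℂ) : Prop :=
  ∀ (i j k l : Fin 9), i ≠ j → i ≠ k → j ≠ k →
    ∀ (hil : i ≠ l) (hjl : j ≠ l) (hkl : k ≠ l),
      sigma br γ (e2 j k) * sigma br γ (e3 j k l)
          * latticeTau τ (eM i) * latticeTau τ (lineM i l hil)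
        + sigma br γ (e2 k i) * sigma br γ (e3 k i l)
          * latticeTau τ (eM j) * latticeTau τ (lineM j l hjl)
        + sigma br γ (e2 i j) * sigma br γ (e3 i j l)
          * latticeTau τ (eM k) * latticeTau τ (lineM k l hkl) = 0

/-- Condition (b): the Hirota relations for sextuples `u_i, u_i'` (here `u i`, `u' i`) in `M`. -/
def SextupleRelations (br : ℂ → ℂ) (γ : X → Hbar) (τ : X → ℂ) : Prop :=
  ∀ u u' : Fin 3 → M,
    (∀ i j, (u i : H) + u' i = u j + u' j) →
    (∀ i j, ipr ((u i : H) - u' i) ((u j : H) - u' j) = if i = j then 4 else 0) →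
      sigma br γ (diffM (u 1) (u 2)) * sigma br γ (diffM (u 1) (u' 2))
          * latticeTau τ (u 0) * latticeTau τ (u' 0)
        + sigma br γ (diffM (u 2) (u 0)) * sigma br γ (diffM (u 2) (u' 0))
          * latticeTau τ (u 1) * latticeTau τ (u' 1)
        + sigma br γ (diffM (u 0) (u 1)) * sigma br γ (diffM (u 0) (u' 1))
          * latticeTau τ (u 2) * latticeTau τ (u' 2) = 0

/-- A triple `a₀, a₁, a₂ ∈ ½ Q(E₈)` such that `{±a₀, ±a₁, ±a₂}` is a `C₃`-frame relative to
`Q(E₈)`. -/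
def IsC3Frame (a : Fin 3 → halfQE8) : Prop :=
  (∀ i j, ipr (a i : H) (a j) = if i = j then 1 else 0) ∧
    ∀ i j, (a i : H) + a j ∈ QE8 ∧ (a i : H) - a j ∈ QE8 ∧
      -(a i : H) + a j ∈ QE8 ∧ -(a i : H) - a j ∈ QE8

/-- Condition (c): the non-autonomous Hirota equations for all `C₃`-frames. -/
def FrameHirota (br : ℂ → ℂ) (γ : X → Hbar) (τ : X → ℂ) : Prop :=
  ∀ a : Fin 3 → halfQE8, IsC3Frame a →
    sigma br γ (toH0 (a 1) + toH0 (a 2)) * sigma br γ (toH0 (a 1) - toH0 (a 2))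
        * actFun (T (a 0)) τ * actFun (T (a 0))⁻¹ τ
      + sigma br γ (toH0 (a 2) + toH0 (a 0)) * sigma br γ (toH0 (a 2) - toH0 (a 0))
        * actFun (T (a 1)) τ * actFun (T (a 1))⁻¹ τ
      + sigma br γ (toH0 (a 0) + toH0 (a 1)) * sigma br γ (toH0 (a 0) - toH0 (a 1))
        * actFun (T (a 2)) τ * actFun (T (a 2))⁻¹ τ = 0

end Functions

end NinePoints

end

/-!
The three conditions are linked by `(a) → (c) → (b) → (a)`.

Since `⟨Λ, Λ⟩ = 1` on `M`, a point `Λ` of `M` is `e₉ + p + ½⟨p, p⟩ c` for some `p ∈ Q(E₈)`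
(`exists_eq_of_mem_M`), and `T_{Λ - e₉} = T_p`. For a sextuple as in (b), the classical parts of
`u_i`, `u_i'` are `b + a_i`, `b - a_i`, where `b` and the `a_i` lie in `½ Q(E₈)` and the `a_i` form
a `C₃`-frame. The value at `x` of the sextuple relation is then the value at `T_b x` of the Hirota
equation of the frame (`exists_frame_of_sextuple`): the factors `τ` match because translations
compose additively, the factors `σ` because `γ` is equivariant and the coefficients `½⟨p, p⟩` of
`c` account for the effect of `T_b` on `𝔥₀`. Hence (c) implies (b), and the single relation (a) for
one choice of indices gives the Hirota equation of one frame at all points of `X`. As `τ` is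
`W(E₈)`-invariant, `W(E₈)` permutes the Hirota equations (`hirotaLHS_weyl`), and it acts
transitively on ordered frames (`exists_weyl_frame`); so (a) implies (c). Finally (a) is a special
case of (b), up to a sign that comes from the oddness of the bracket (`IsBracket.neg`).

Transitivity on frames: `a₁ - a₂`, `a₀ - a₁`, `a₁ + a₂` are consecutive roots of an `A₃`-diagram.
Its middle root is moved into the dominant chamber of `E₈`, the next one into that of `E₇` and the
last one into that of `E₆`, each time by the parabolic subgroup that fixes the previous roots. A
bound on the coordinates of a root shows that each of these dominant roots is unique.
-/

noncomputable section

namespace NinePoints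

/-! ### The lattice `Q(E₈)` in coordinates -/

/-- The vector `d e₀ - m₁ e₁ - ⋯ - m₈ e₈` with integral coordinates; `m i` for `i : Fin 8`
is the coordinate `m_{i+1}`. -/
def intVec (d : ℤ) (m : Fin 8 → ℤ) : H :=
  ![(d : ℂ), -m 0, -m 1, -m 2, -m 3, -m 4, -m 5, -m 6, -m 7, 0]

theorem ipr_intVec (d d' : ℤ) (m m' : Fin 8 → ℤ) :
    ipr (intVec d m) (intVec d' m') = ((-(d * d') + ∑ i, m i * m' i : ℤ) : ℂ) := by
  rw [ipr_apply]
  simp [intVec, Fin.sum_univ_succ]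

theorem intVec_add (d d' : ℤ) (m m' : Fin 8 → ℤ) :
    intVec d m + intVec d' m' = intVec (d + d') (m + m') := by
  ext i
  fin_cases i <;> simp [intVec] <;> ring

theorem intVec_neg (d : ℤ) (m : Fin 8 → ℤ) : -intVec d m = intVec (-d) (-m) := by
  ext i
  fin_cases i <;> simp [intVec]

theorem simpleRoot_eq_intVec_zero :
    simpleRoot (0 : Fin 8).castSucc = intVec 1 ![1, 1, 1, 0, 0, 0, 0, 0] := by
  ext i
  fin_cases i <;> simp [simpleRoot, intVec, e, Fin.ext_iff]

theorem simpleRoot_eq_intVec_succ (j : Fin 7) :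
    simpleRoot j.succ.castSucc =
      intVec 0 (Pi.single j.succ 1 - Pi.single j.castSucc 1) := by
  ext i
  fin_cases j <;> fin_cases i <;> simp [simpleRoot, intVec, e, Fin.ext_iff]

/-- Every `q ∈ Q(E₈)` is an `intVec`; the condition `⟨c, q⟩ = 0` reads `∑ m_i = 3 d`. -/
theorem exists_intVec {q : H} (hq : q ∈ QE8) :
    ∃ (d : ℤ) (m : Fin 8 → ℤ), q = intVec d m ∧ ∑ i, m i = 3 * d := by
  induction hq using AddSubgroup.closure_induction with
  | mem x hx =>
    obtain ⟨j, rfl⟩ := hx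
    refine Fin.cases ?_ (fun j => ?_) j
    · exact ⟨_, _, simpleRoot_eq_intVec_zero, by simp [Fin.sum_univ_succ]⟩
    · exact ⟨_, _, simpleRoot_eq_intVec_succ j, by simp [Finset.sum_sub_distrib]⟩
  | zero => exact ⟨0, 0, by ext i; fin_cases i <;> simp [intVec], by simp⟩
  | add x y _ _ hx hy =>
    obtain ⟨d, m, rfl, h⟩ := hx
    obtain ⟨d', m', rfl, h'⟩ := hy
    exact ⟨_, _, intVec_add .., by simp [Finset.sum_add_distrib, h, h', mul_add]⟩
  | neg x _ hx =>
    obtain ⟨d, m, rfl, h⟩ := hx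
    exact ⟨_, _, intVec_neg .., by simp [Finset.sum_neg_distrib, h]⟩

theorem QE8_le_L : QE8 ≤ L := by
  refine (AddSubgroup.closure_le _).2 ?_
  rintro _ ⟨j, rfl⟩
  exact simpleRoot_mem_L _

theorem simpleRoot_mem_QE8 (j : Fin 8) : simpleRoot j.castSucc ∈ QE8 :=
  AddSubgroup.subset_closure ⟨j, rfl⟩

theorem ipr_e9_QE8 {q : H} (hq : q ∈ QE8) : ipr (e 9) q = 0 := by
  obtain ⟨d, m, rfl, -⟩ := exists_intVec hq
  rw [ipr_apply]
  simp [intVec, e, Fin.sum_univ_succ, Fin.ext_iff]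

/-! ### The Weyl group `W(E₈)` -/

theorem ipr_s_s (j : Fin 9) (u v : H) : ipr (s j u) (s j v) = ipr u v := by
  have h := ipr_simpleRoot_self j
  have h1 := ipr_comm u (simpleRoot j)
  simp only [s_apply, map_sub, map_smul, LinearMap.sub_apply, LinearMap.smul_apply, smul_eq_mul,
    h, h1]
  ring

theorem ipr_affineWeyl {w : H ≃ₗ[ℂ] H} (hw : w ∈ affineWeylE8) (u v : H) :
    ipr (w u) (w v) = ipr u v := by
  induction hw using Subgroup.closure_induction generalizing u v with
  | mem x hx =>
    obtain ⟨j, rfl⟩ := hx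
    exact ipr_s_s _ u v
  | one => rfl
  | mul x y _ _ hx hy => exact (hx _ _).trans (hy u v)
  | inv x _ hx =>
    rw [← hx (x⁻¹ u) (x⁻¹ v)]
    exact congrArg₂ (fun a b => ipr a b) (x.apply_symm_apply u) (x.apply_symm_apply v)

theorem weylE8_le_affineWeylE8 : weylE8 ≤ affineWeylE8 :=
  Subgroup.closure_mono (Set.range_comp_subset_range Fin.castSucc s)

theorem ipr_weyl {w : H ≃ₗ[ℂ] H} (hw : w ∈ weylE8) (u v : H) : ipr (w u) (w v) = ipr u v :=
  ipr_affineWeyl (weylE8_le_affineWeylE8 hw) u v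

theorem weyl_mem_G {w : H ≃ₗ[ℂ] H} (hw : w ∈ weylE8) : w ∈ G :=
  (le_sup_right : weylE8 ≤ G) hw

theorem s_mem_QE8 (j : Fin 8) {q : H} (hq : q ∈ QE8) : s j.castSucc q ∈ QE8 := by
  obtain ⟨n, hn⟩ := ipr_L_int (simpleRoot_mem_L j.castSucc) (QE8_le_L hq)
  rw [s_apply, hn, Int.cast_smul_eq_zsmul]
  exact sub_mem hq (zsmul_mem (simpleRoot_mem_QE8 j) n)

theorem weyl_mem_QE8 {w : H ≃ₗ[ℂ] H} (hw : w ∈ weylE8) {q : H} (hq : q ∈ QE8) : w q ∈ QE8 := by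
  rw [weylE8, ← Subgroup.mem_toSubmonoid, Subgroup.closure_toSubmonoid] at hw
  induction hw using Submonoid.closure_induction generalizing q with
  | mem x hx =>
    rcases hx with ⟨j, rfl⟩ | ⟨j, hj⟩
    · exact s_mem_QE8 j hq
    · have : x = s j.castSucc := by
        rw [← inv_inv x, ← hj]
        exact inv_eq_of_mul_eq_one_left (LinearEquiv.ext (s_s j.castSucc))
      rw [this]
      exact s_mem_QE8 j hq
  | one => exact hq
  | mul x y _ _ hx hy => exact hx (hy hq)

/-- The parabolic subgroup `⟨s_j | j ∈ J⟩` of `W(E₈)`. -/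
def parabolic (J : Set (Fin 8)) : Subgroup (H ≃ₗ[ℂ] H) :=
  Subgroup.closure ((fun j : Fin 8 => s j.castSucc) '' J)

theorem parabolic_le_weylE8 (J : Set (Fin 8)) : parabolic J ≤ weylE8 :=
  Subgroup.closure_mono (Set.image_subset_range _ _)

theorem parabolic_apply_eq_self {J : Set (Fin 8)} {v : H}
    (hv : ∀ j ∈ J, ipr (simpleRoot j.castSucc) v = 0) {w : H ≃ₗ[ℂ] H} (hw : w ∈ parabolic J) :
    w v = v := by
  have h : parabolic J ≤ MulAction.stabilizer (H ≃ₗ[ℂ] H) v := by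
    refine (Subgroup.closure_le _).2 ?_
    rintro _ ⟨j, hj, rfl⟩
    show s j.castSucc v = v
    rw [s_apply, hv j hj, zero_smul, sub_zero]
  exact h hw

/-! ### Dominant roots -/

/-- The vector `5 e₀ - e₁ - 2 e₂ - ⋯ - 8 e₈`, which pairs to `1` with the simple roots of
`E₈`, so that pairing with it is the height function. -/
def rhoVec : H := intVec 5 ![1, 2, 3, 4, 5, 6, 7, 8]

theorem ipr_rhoVec_simpleRoot (j : Fin 8) : ipr rhoVec (simpleRoot j.castSucc) = 1 := by
  refine Fin.cases ?_ (fun j => ?_) j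
  · rw [simpleRoot_eq_intVec_zero, rhoVec, ipr_intVec]
    simp [Fin.sum_univ_succ]
  · rw [simpleRoot_eq_intVec_succ, rhoVec, ipr_intVec]
    simp only [Pi.sub_apply, mul_sub, Finset.sum_sub_distrib, Pi.single_apply, mul_ite, mul_one,
      mul_zero, Finset.sum_ite_eq', Finset.mem_univ, if_true]
    fin_cases j <;> simp

theorem norm_two_coords {d : ℤ} {m : Fin 8 → ℤ} (h : ipr (intVec d m) (intVec d m) = 2) :
    m 0 ^ 2 + m 1 ^ 2 + m 2 ^ 2 + m 3 ^ 2 + m 4 ^ 2 + m 5 ^ 2 + m 6 ^ 2 + m 7 ^ 2 = d ^ 2 + 2 := by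
  rw [ipr_intVec] at h
  have h' : -(d * d) + ∑ i, m i * m i = 2 := by exact_mod_cast h
  simp [Fin.sum_univ_eight] at h'
  linarith

theorem sq_le_of_norm_two {d : ℤ} {m : Fin 8 → ℤ} (h2 : ipr (intVec d m) (intVec d m) = 2)
    (hs : ∑ i, m i = 3 * d) : d ^ 2 ≤ 16 := by
  have hn := norm_two_coords h2
  simp only [Fin.sum_univ_eight] at hs
  -- the Cauchy–Schwarz inequality for `m` and the constant vector
  have hsd := congrArg (· * d) hs
  nlinarith [sq_nonneg (8 * m 0 - 3 * d), sq_nonneg (8 * m 1 - 3 * d),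
    sq_nonneg (8 * m 2 - 3 * d), sq_nonneg (8 * m 3 - 3 * d), sq_nonneg (8 * m 4 - 3 * d),
    sq_nonneg (8 * m 5 - 3 * d), sq_nonneg (8 * m 6 - 3 * d), sq_nonneg (8 * m 7 - 3 * d)]

/-- The height of a root is bounded above; `200` is a convenient bound. -/
theorem height_le {q : H} (hq : q ∈ QE8) (h2 : ipr q q = 2) :
    ∃ n : ℕ, ipr rhoVec q = 200 - (n : ℂ) := by
  obtain ⟨d, m, rfl, hs⟩ := exists_intVec hq
  have hn := norm_two_coords h2
  have hd := sq_le_of_norm_two h2 hs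
  simp only [Fin.sum_univ_eight] at hs
  have hd4 : -4 ≤ d := by nlinarith
  have hm : ∀ i, m i ≤ 4 := by
    intro i
    have : m i ^ 2 ≤ d ^ 2 + 2 := by
      have := Finset.single_le_sum (f := fun i => m i ^ 2) (fun _ _ => sq_nonneg _)
        (Finset.mem_univ i)
      simp only [Fin.sum_univ_eight] at this
      linarith
    nlinarith
  refine ⟨(200 - (-(5 * d) + ∑ i, ![1, 2, 3, 4, 5, 6, 7, 8] i * m i)).toNat, ?_⟩
  rw [rhoVec, ipr_intVec, ← Int.cast_natCast (R := ℂ), Int.toNat_of_nonneg]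
  · push_cast
    ring
  · simp [Fin.sum_univ_eight]
    linarith [hm 0, hm 1, hm 2, hm 3, hm 4, hm 5, hm 6, hm 7]

/-- Every root of `Q(E₈)` is carried into the dominant chamber of a parabolic subgroup by an
element of this subgroup: as long as a simple reflection raises the height, apply it. -/
theorem exists_dominant (J : Set (Fin 8)) {q : H} (hq : q ∈ QE8) (h2 : ipr q q = 2) :
    ∃ w ∈ parabolic J, ∀ j ∈ J, ∃ n : ℕ, ipr (simpleRoot j.castSucc) (w q) = n := by
  obtain ⟨N, hN⟩ := height_le hq h2
  induction N using Nat.strong_induction_on generalizing q with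
  | _ N ih =>
    by_cases hdom : ∀ j ∈ J, ∃ n : ℕ, ipr (simpleRoot j.castSucc) q = n
    · exact ⟨1, one_mem _, hdom⟩
    push Not at hdom
    obtain ⟨j, hj, hneg⟩ := hdom
    obtain ⟨k, hk⟩ := ipr_L_int (simpleRoot_mem_L j.castSucc) (QE8_le_L hq)
    have hk0 : k < 0 := by
      by_contra hcon
      refine hneg k.toNat ?_
      rw [hk, ← Int.cast_natCast (R := ℂ), Int.toNat_of_nonneg (by linarith)]
    have hq' := s_mem_QE8 j hq
    have h2' : ipr (s j.castSucc q) (s j.castSucc q) = 2 := by rw [ipr_s_s, h2]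
    obtain ⟨N', hN'⟩ := height_le hq' h2'
    have hlt : N' < N := by
      have h1 : ipr rhoVec (s j.castSucc q) = 200 - N - k := by
        rw [s_apply, map_sub, map_smul, ipr_rhoVec_simpleRoot, hk, hN]
        simp
      rw [hN'] at h1
      have : (200 - N' : ℤ) = 200 - N - k := by exact_mod_cast h1
      omega
    obtain ⟨w, hw, hdom⟩ := ih N' hlt hq' h2' hN'
    exact ⟨w * s j.castSucc, mul_mem hw (Subgroup.subset_closure ⟨j, hj, rfl⟩), hdom⟩

/-- Nonnegativity of the pairing with `α₀`, in coordinates. -/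
theorem dominant_zero {d : ℤ} {m : Fin 8 → ℤ}
    (h : ∃ n : ℕ, ipr (simpleRoot (0 : Fin 8).castSucc) (intVec d m) = n) :
    d ≤ m 0 + m 1 + m 2 := by
  obtain ⟨n, hn⟩ := h
  rw [simpleRoot_eq_intVec_zero, ipr_intVec] at hn
  have hn' : -(1 * d) + ∑ i, ![1, 1, 1, 0, 0, 0, 0, 0] i * m i = (n : ℤ) := by exact_mod_cast hn
  simp [Fin.sum_univ_eight] at hn'
  omega

/-- Nonnegativity of the pairings with `α₁, …, α₇`, in coordinates. -/
theorem dominant_succ {d : ℤ} {m : Fin 8 → ℤ} {j : Fin 7}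
    (h : ∃ n : ℕ, ipr (simpleRoot j.succ.castSucc) (intVec d m) = n) :
    m j.castSucc ≤ m j.succ := by
  obtain ⟨n, hn⟩ := h
  rw [simpleRoot_eq_intVec_succ, ipr_intVec] at hn
  have hn' : -(0 * d) + ∑ i, (Pi.single j.succ 1 - Pi.single j.castSucc 1 : Fin 8 → ℤ) i * m i
      = (n : ℤ) := by exact_mod_cast hn
  simp [sub_mul, Finset.sum_sub_distrib, Pi.single_apply] at hn'
  omega

theorem intVec_congr {d d' : ℤ} {m m' : Fin 8 → ℤ} (hd : d = d') (h0 : m 0 = m' 0)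
    (h1 : m 1 = m' 1) (h2 : m 2 = m' 2) (h3 : m 3 = m' 3) (h4 : m 4 = m' 4) (h5 : m 5 = m' 5)
    (h6 : m 6 = m' 6) (h7 : m 7 = m' 7) : intVec d m = intVec d' m' := by
  simp [intVec, hd, h0, h1, h2, h3, h4, h5, h6, h7]

/-- The highest root `3 e₀ - e₁ - ⋯ - e₇ - 2 e₈` of `E₈`. -/
def highestRoot : H := intVec 3 ![1, 1, 1, 1, 1, 1, 1, 2]

/-- A dominant root is the highest root: dominance bounds `m₃, …, m₈` below in terms of `d`, which
together with `∑ m_i = 3 d` and the norm leaves a single possibility. -/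
theorem eq_highestRoot {q : H} (hq : q ∈ QE8) (h2 : ipr q q = 2)
    (hdom : ∀ j : Fin 8, ∃ n : ℕ, ipr (simpleRoot j.castSucc) q = n) : q = highestRoot := by
  obtain ⟨d, m, rfl, hs⟩ := exists_intVec hq
  have hn := norm_two_coords h2
  have hd := sq_le_of_norm_two h2 hs
  simp only [Fin.sum_univ_eight] at hs
  have hd4 : d ≤ 4 := by nlinarith
  have g0 := dominant_zero (hdom 0)
  have g1 : m 0 ≤ m 1 := dominant_succ (hdom (Fin.succ 0))
  have g2 : m 1 ≤ m 2 := dominant_succ (hdom (Fin.succ 1))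
  have g3 : m 2 ≤ m 3 := dominant_succ (hdom (Fin.succ 2))
  have g4 : m 3 ≤ m 4 := dominant_succ (hdom (Fin.succ 3))
  have g5 : m 4 ≤ m 5 := dominant_succ (hdom (Fin.succ 4))
  have g6 : m 5 ≤ m 6 := dominant_succ (hdom (Fin.succ 5))
  have g7 : m 6 ≤ m 7 := dominant_succ (hdom (Fin.succ 6))
  have hd0 : d ≠ 0 := by
    rintro rfl
    have e0 : m 0 = 0 := by omega
    have e1 : m 1 = 0 := by omega
    have e2 : m 2 = 0 := by omega
    have e3 : m 3 = 0 := by omega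
    have e4 : m 4 = 0 := by omega
    have e5 : m 5 = 0 := by omega
    have e6 : m 6 = 0 := by omega
    have e7 : m 7 = 0 := by omega
    simp [e0, e1, e2, e3, e4, e5, e6, e7] at hn
  have hd3 : d = 3 := by omega
  subst hd3
  apply intVec_congr <;> simp <;> omega

theorem ipr_highestRoot (d : ℤ) {m : Fin 8 → ℤ} (hs : ∑ i, m i = 3 * d) :
    ipr highestRoot (intVec d m) = (m 7 : ℂ) := by
  rw [highestRoot, ipr_intVec, Int.cast_inj]
  simp [Fin.sum_univ_eight] at hs ⊢
  linarith

theorem ipr_simpleRoot_highestRoot {j : Fin 8} (hj : j < 7) :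
    ipr (simpleRoot j.castSucc) highestRoot = 0 := by
  rw [ipr_comm]
  revert hj
  refine Fin.cases (fun _ => ?_) (fun j hj => ?_) j
  · rw [simpleRoot_eq_intVec_zero, ipr_highestRoot _ (by simp [Fin.sum_univ_succ])]
    simp
  · rw [simpleRoot_eq_intVec_succ, ipr_highestRoot _ (by simp [Finset.sum_sub_distrib])]
    revert hj
    fin_cases j <;> simp [Fin.ext_iff]

/-- The condition `⟨θ, q⟩ = -1` for the highest root `θ` says that the coordinate `m₈` of `q` is
`-1`; the roots with this property are the weights of a minuscule representation of `E₇`, of which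
only one is dominant. -/
theorem eq_neg_simpleRoot_seven {q : H} (hq : q ∈ QE8) (h2 : ipr q q = 2)
    (hθ : ipr highestRoot q = -1)
    (hdom : ∀ j ∈ {j : Fin 8 | j < 7}, ∃ n : ℕ, ipr (simpleRoot j.castSucc) q = n) :
    q = -simpleRoot (7 : Fin 8).castSucc := by
  obtain ⟨d, m, rfl, hs⟩ := exists_intVec hq
  have hn := norm_two_coords h2
  rw [ipr_highestRoot d hs] at hθ
  have hm7 : m 7 = -1 := by exact_mod_cast hθ
  simp only [Fin.sum_univ_eight, hm7] at hs hn
  -- the Cauchy–Schwarz inequality for the coordinates not yet determined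
  have hd : d ^ 2 + 3 * d ≤ 3 := by
    nlinarith [sq_nonneg (7 * m 0 - 3 * d - 1), sq_nonneg (7 * m 1 - 3 * d - 1),
      sq_nonneg (7 * m 2 - 3 * d - 1), sq_nonneg (7 * m 3 - 3 * d - 1),
      sq_nonneg (7 * m 4 - 3 * d - 1), sq_nonneg (7 * m 5 - 3 * d - 1),
      sq_nonneg (7 * m 6 - 3 * d - 1)]
  have hd4 : d ≤ 0 := by nlinarith
  have g0 := dominant_zero (hdom 0 (by decide))
  have g1 : m 0 ≤ m 1 := dominant_succ (hdom (Fin.succ 0) (by decide))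
  have g2 : m 1 ≤ m 2 := dominant_succ (hdom (Fin.succ 1) (by decide))
  have g3 : m 2 ≤ m 3 := dominant_succ (hdom (Fin.succ 2) (by decide))
  have g4 : m 3 ≤ m 4 := dominant_succ (hdom (Fin.succ 3) (by decide))
  have g5 : m 4 ≤ m 5 := dominant_succ (hdom (Fin.succ 4) (by decide))
  have g6 : m 5 ≤ m 6 := dominant_succ (hdom (Fin.succ 5) (by decide))
  have h7 : simpleRoot (7 : Fin 8).castSucc = intVec 0 ![0, 0, 0, 0, 0, 0, -1, 1] := by
    rw [show (7 : Fin 8) = Fin.succ 6 from rfl, simpleRoot_eq_intVec_succ]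
    apply intVec_congr <;> simp [Fin.ext_iff]
  have hd0 : d = 0 := by omega
  subst hd0
  rw [h7, intVec_neg]
  apply intVec_congr <;> simp <;> omega

/-- The roots with `⟨θ, q⟩ = -1` and `⟨α₇, q⟩ = 0` are the weights of a minuscule representation of
`E₆`; again only one of them is dominant. -/
theorem eq_third_root {q : H} (hq : q ∈ QE8) (h2 : ipr q q = 2)
    (hθ : ipr highestRoot q = -1) (h7 : ipr (simpleRoot (7 : Fin 8).castSucc) q = 0)
    (hdom : ∀ j ∈ {j : Fin 8 | j < 6}, ∃ n : ℕ, ipr (simpleRoot j.castSucc) q = n) :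
    q = intVec (-1) ![-1, 0, 0, 0, 0, 0, -1, -1] := by
  obtain ⟨d, m, rfl, hs⟩ := exists_intVec hq
  have hn := norm_two_coords h2
  rw [ipr_highestRoot d hs] at hθ
  have hm7 : m 7 = -1 := by exact_mod_cast hθ
  have hm6 : m 6 = -1 := by
    rw [show (7 : Fin 8) = Fin.succ 6 from rfl, simpleRoot_eq_intVec_succ, ipr_intVec] at h7
    have h7' : -(0 * d) + ∑ i, (Pi.single (Fin.succ 6) 1 - Pi.single (Fin.castSucc 6) 1
      : Fin 8 → ℤ) i * m i = 0 := by exact_mod_cast h7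
    simp [sub_mul, Finset.sum_sub_distrib, Pi.single_apply] at h7'
    omega
  simp only [Fin.sum_univ_eight, hm7, hm6] at hs hn
  -- the Cauchy–Schwarz inequality for the coordinates not yet determined
  have hd : 3 * d ^ 2 + 12 * d + 4 ≤ 0 := by
    nlinarith [sq_nonneg (6 * m 0 - 3 * d - 2), sq_nonneg (6 * m 1 - 3 * d - 2),
      sq_nonneg (6 * m 2 - 3 * d - 2), sq_nonneg (6 * m 3 - 3 * d - 2),
      sq_nonneg (6 * m 4 - 3 * d - 2), sq_nonneg (6 * m 5 - 3 * d - 2)]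
  have hd4 : d < 0 := by nlinarith
  have g0 := dominant_zero (hdom 0 (by decide))
  have g1 : m 0 ≤ m 1 := dominant_succ (hdom (Fin.succ 0) (by decide))
  have g2 : m 1 ≤ m 2 := dominant_succ (hdom (Fin.succ 1) (by decide))
  have g3 : m 2 ≤ m 3 := dominant_succ (hdom (Fin.succ 2) (by decide))
  have g4 : m 3 ≤ m 4 := dominant_succ (hdom (Fin.succ 3) (by decide))
  have g5 : m 4 ≤ m 5 := dominant_succ (hdom (Fin.succ 4) (by decide))
  have hd0 : d = -1 := by omega
  subst hd0
  have hm0 : -1 ≤ m 0 := by nlinarith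
  apply intVec_congr <;> simp <;> omega


/-! ### Transitivity of `W(E₈)` on `C₃`-frames -/

/-- `W(E₈)` acts transitively on ordered `A₃`-subsystems of roots `x — y — z`. The middle root is
moved to the highest root; the stabilizer of the latter contains `⟨s₀, …, s₆⟩`, which moves `x`
to `-α₇`, and the stabilizer of both contains `⟨s₀, …, s₅⟩`, which normalizes `z`. -/
theorem exists_weyl_chain {x y z : H} (hx : x ∈ QE8) (hy : y ∈ QE8) (hz : z ∈ QE8)
    (hxx : ipr x x = 2) (hyy : ipr y y = 2) (hzz : ipr z z = 2) (hyx : ipr y x = -1)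
    (hyz : ipr y z = -1) (hxz : ipr x z = 0) :
    ∃ w ∈ weylE8, w y = highestRoot ∧ w x = -simpleRoot (7 : Fin 8).castSucc ∧
      w z = intVec (-1) ![-1, 0, 0, 0, 0, 0, -1, -1] := by
  have hle := parabolic_le_weylE8
  obtain ⟨w₁, hw₁, hd₁⟩ := exists_dominant Set.univ hy hyy
  have h₁ := hle _ hw₁
  have hy₁ : w₁ y = highestRoot := eq_highestRoot (weyl_mem_QE8 h₁ hy)
    (by rw [ipr_weyl h₁, hyy]) fun j => hd₁ j trivial
  obtain ⟨w₂, hw₂, hd₂⟩ := exists_dominant {j : Fin 8 | j < 7} (weyl_mem_QE8 h₁ hx)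
    (by rw [ipr_weyl h₁, hxx])
  have h₂ := hle _ hw₂
  have hfix₂ : w₂ highestRoot = highestRoot :=
    parabolic_apply_eq_self (fun j hj => ipr_simpleRoot_highestRoot hj) hw₂
  have h₂₁ := mul_mem h₂ h₁
  have hy₂ : (w₂ * w₁) y = highestRoot := by rw [LinearEquiv.mul_apply, hy₁, hfix₂]
  have hx₂ : (w₂ * w₁) x = -simpleRoot (7 : Fin 8).castSucc :=
    eq_neg_simpleRoot_seven (weyl_mem_QE8 h₂₁ hx) (by rw [ipr_weyl h₂₁, hxx])
      (by rw [← hy₂, ipr_weyl h₂₁, hyx]) hd₂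
  obtain ⟨w₃, hw₃, hd₃⟩ := exists_dominant {j : Fin 8 | j < 6} (weyl_mem_QE8 h₂₁ hz)
    (by rw [ipr_weyl h₂₁, hzz])
  have h₃ := hle _ hw₃
  have h₃₂₁ := mul_mem h₃ h₂₁
  have hy₃ : (w₃ * (w₂ * w₁)) y = highestRoot := by
    rw [LinearEquiv.mul_apply, hy₂]
    exact parabolic_apply_eq_self
      (fun j (hj : j < 6) => ipr_simpleRoot_highestRoot (hj.trans (by decide))) hw₃
  have hx₃ : (w₃ * (w₂ * w₁)) x = -simpleRoot (7 : Fin 8).castSucc := by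
    rw [LinearEquiv.mul_apply, hx₂]
    refine parabolic_apply_eq_self (fun j hj => ?_) hw₃
    rw [map_neg, neg_eq_zero]
    revert hj
    rw [show (7 : Fin 8) = Fin.succ 6 from rfl, simpleRoot_eq_intVec_succ]
    refine Fin.cases ?_ (fun j => ?_) j
    · intro _
      rw [simpleRoot_eq_intVec_zero, ipr_intVec]
      simp [Fin.sum_univ_succ]
    · rw [simpleRoot_eq_intVec_succ, ipr_intVec]
      simp only [Pi.sub_apply, mul_sub, Finset.sum_sub_distrib, Pi.single_apply, mul_ite, mul_one,
        mul_zero, Finset.sum_ite_eq', Finset.mem_univ, if_true]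
      fin_cases j <;> simp [Fin.ext_iff]
  refine ⟨_, h₃₂₁, hy₃, hx₃, ?_⟩
  refine eq_third_root (weyl_mem_QE8 h₃₂₁ hz) (by rw [ipr_weyl h₃₂₁, hzz])
      (by rw [← hy₃, ipr_weyl h₃₂₁, hyz]) ?_ hd₃
  rw [← neg_eq_zero, ← LinearMap.neg_apply, ← map_neg, ← hx₃, ipr_weyl h₃₂₁, hxz]

/-- Any two ordered `C₃`-frames are conjugate under `W(E₈)`: the roots `a₁ - a₂`, `a₀ - a₁`,
`a₁ + a₂` form a chain of type `A₃`, which determines the frame. -/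
theorem exists_weyl_frame {a b : Fin 3 → halfQE8} (ha : IsC3Frame a) (hb : IsC3Frame b) :
    ∃ w ∈ weylE8, ∀ i, (b i : H) = w (a i) := by
  have key : ∀ {a : Fin 3 → halfQE8}, IsC3Frame a → ∃ w ∈ weylE8,
      w ((a 0 : H) - a 1) = highestRoot ∧ w ((a 1 : H) - a 2) = -simpleRoot (7 : Fin 8).castSucc ∧
      w ((a 1 : H) + a 2) = intVec (-1) ![-1, 0, 0, 0, 0, 0, -1, -1] := by
    intro a ha
    have h := ha.1
    apply exists_weyl_chain (ha.2 1 2).2.1 (ha.2 0 1).2.1 (ha.2 1 2).1 <;>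
      simp only [map_add, map_sub, LinearMap.add_apply, LinearMap.sub_apply, h] <;>
      simp [Fin.ext_iff] <;> norm_num
  obtain ⟨w, hw, h1, h2, h3⟩ := key ha
  obtain ⟨w', hw', h1', h2', h3'⟩ := key hb
  rw [← h1', map_sub, map_sub] at h1
  rw [← h2', map_sub, map_sub] at h2
  rw [← h3', map_add, map_add] at h3
  have e1 : w (a 1) = w' (b 1) := by
    linear_combination (norm := module) (1 / 2 : ℂ) • h2 + (1 / 2 : ℂ) • h3
  have e2 : w (a 2) = w' (b 2) := by
    linear_combination (norm := module) (1 / 2 : ℂ) • h3 - (1 / 2 : ℂ) • h2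
  have e0 : w (a 0) = w' (b 0) := by
    linear_combination (norm := module) h1 + e1
  refine ⟨w'⁻¹ * w, mul_mem (inv_mem hw') hw, fun i => ?_⟩
  have hi : w (a i) = w' (b i) := by fin_cases i <;> assumption
  rw [LinearEquiv.mul_apply, hi]
  exact (w'.symm_apply_apply _).symm

/-! ### The points of `M` -/

/-- A point `Λ` of `M` is determined by its classical part `p ∈ Q(E₈)`, since `⟨Λ, Λ⟩ = 1`. -/
theorem exists_eq_of_mem_M {u : H} (hu : u ∈ M) :
    ∃ p ∈ QE8, u = e 9 + p + ((1 / 2 : ℂ) * ipr p p) • c := by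
  have hnorm : ipr u u = 1 := by
    obtain ⟨w, hw, rfl⟩ := hu
    rw [ipr_affineWeyl hw, ipr_e]
    simp
  obtain ⟨-, p, hp, k, hk⟩ := M_mod_c hu
  have hu' : u = e 9 + p + (k : ℂ) • c := by rw [add_assoc, ← hk]; abel
  refine ⟨p, hp, ?_⟩
  have h9 := ipr_e9_QE8 hp
  have h9' : ipr p (e 9) = 0 := by rw [ipr_comm, h9]
  have hc : ipr c p = 0 := mem_H0.1 (QE8_le_H0 hp)
  have hc' : ipr p c = 0 := by rw [ipr_comm, hc]
  have hc9 : ipr c (e 9) = -1 := ipr_c_e_succ 8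
  have hc9' : ipr (e 9) c = -1 := by rw [ipr_comm, hc9]
  have h99 : ipr (e 9) (e 9) = 1 := by simp [ipr_e]
  have hkk : (1 / 2 : ℂ) * ipr p p = k := by
    rw [hu'] at hnorm
    simp only [map_add, map_smul, LinearMap.add_apply, LinearMap.smul_apply, smul_eq_mul, h9, h9',
      hc, hc', hc9, hc9', h99, ipr_c_c] at hnorm
    linear_combination hnorm / 2
  rw [hkk, hu']

/-! ### Both sides of the relations as functions on `X` -/

section Functions

variable {X : Type*} [MulAction G X]

/-- The left-hand side of the Hirota equation of a triple `a₀, a₁, a₂`. -/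
def hirotaLHS (br : ℂ → ℂ) (γ : X → Hbar) (τ : X → ℂ) (a : Fin 3 → halfQE8) : X → ℂ :=
  sigma br γ (toH0 (a 1) + toH0 (a 2)) * sigma br γ (toH0 (a 1) - toH0 (a 2))
      * actFun (T (a 0)) τ * actFun (T (a 0))⁻¹ τ
    + sigma br γ (toH0 (a 2) + toH0 (a 0)) * sigma br γ (toH0 (a 2) - toH0 (a 0))
      * actFun (T (a 1)) τ * actFun (T (a 1))⁻¹ τ
    + sigma br γ (toH0 (a 0) + toH0 (a 1)) * sigma br γ (toH0 (a 0) - toH0 (a 1))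
      * actFun (T (a 2)) τ * actFun (T (a 2))⁻¹ τ

/-- The left-hand side of the Hirota relation of a sextuple `u_i, u_i'` in `M`. -/
def sextupleLHS (br : ℂ → ℂ) (γ : X → Hbar) (τ : X → ℂ) (u u' : Fin 3 → M) : X → ℂ :=
  sigma br γ (diffM (u 1) (u 2)) * sigma br γ (diffM (u 1) (u' 2))
      * latticeTau τ (u 0) * latticeTau τ (u' 0)
    + sigma br γ (diffM (u 2) (u 0)) * sigma br γ (diffM (u 2) (u' 0))
      * latticeTau τ (u 1) * latticeTau τ (u' 1)
    + sigma br γ (diffM (u 0) (u 1)) * sigma br γ (diffM (u 0) (u' 1))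
      * latticeTau τ (u 2) * latticeTau τ (u' 2)

/-- If `⟨a, g v⟩ = ⟨b, v⟩` for all `v`, then `σ_a (g x) = σ_b (x)`. -/
theorem sigma_smul {br : ℂ → ℂ} {γ : X → Hbar} (hγ : IsEquivariant γ) {g : G} {a b : H0}
    (h : ∀ v, ipr (a : H) ((g : H ≃ₗ[ℂ] H) v) = ipr (b : H) v) (x : X) :
    sigma br γ a (g • x) = sigma br γ b x := by
  unfold sigma
  rw [hγ]
  obtain ⟨v, hv⟩ := Submodule.Quotient.mk_surjective _ (γ x)
  rw [← hv, actBar_mk, pairBar_mk, pairBar_mk, h]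

/-- `T_{w a} = w T_a w⁻¹` for `w ∈ W(E₈)`. -/
theorem T_eq_conj {a b : halfQE8} {w : H ≃ₗ[ℂ] H} (hw : w ∈ weylE8) (h : (b : H) = w a) :
    T b = ⟨w, weyl_mem_G hw⟩ * T a * ⟨w, weyl_mem_G hw⟩⁻¹ := by
  rw [eq_mul_inv_iff_mul_eq]
  refine Subtype.ext (LinearEquiv.ext fun v => ?_)
  have hc : w c = c := G_apply_c (weyl_mem_G hw)
  have hcv : ipr c (w v) = ipr c v := by
    conv_lhs => rw [← hc, ipr_weyl hw]
  show kac _ (w v) = w (kac _ v)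
  rw [kac_apply, kac_apply]
  simp only [h, map_sub, map_add, map_smul, hc, hcv, ipr_weyl hw]

theorem weylInvariant_smul {τ : X → ℂ} (hτ : IsWeylInvariant τ) {w : H ≃ₗ[ℂ] H}
    (hw : w ∈ weylE8) (x : X) : τ ((⟨w, weyl_mem_G hw⟩ : G) • x) = τ x := by
  have h := congrFun (hτ ⟨w, weyl_mem_G hw⟩ hw) ((⟨w, weyl_mem_G hw⟩ : G) • x)
  rw [← h]
  simp [actFun]

/-- The Hirota equations are permuted by `W(E₈)`, since `τ` is invariant. -/
theorem hirotaLHS_weyl {br : ℂ → ℂ} {γ : X → Hbar} (hγ : IsEquivariant γ) {τ : X → ℂ}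
    (hτ : IsWeylInvariant τ) {a b : Fin 3 → halfQE8} {w : H ≃ₗ[ℂ] H} (hw : w ∈ weylE8)
    (h : ∀ i, (b i : H) = w (a i)) (x : X) :
    hirotaLHS br γ τ b ((⟨w, weyl_mem_G hw⟩ : G) • x) = hirotaLHS br γ τ a x := by
  have hadd : ∀ i j, sigma br γ (toH0 (b i) + toH0 (b j)) ((⟨w, weyl_mem_G hw⟩ : G) • x)
      = sigma br γ (toH0 (a i) + toH0 (a j)) x := fun i j => by
    refine sigma_smul hγ (fun v => ?_) x
    show ipr ((b i : H) + b j) (w v) = ipr ((a i : H) + a j) v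
    rw [h, h, ← map_add w, ipr_weyl hw]
  have hsub : ∀ i j, sigma br γ (toH0 (b i) - toH0 (b j)) ((⟨w, weyl_mem_G hw⟩ : G) • x)
      = sigma br γ (toH0 (a i) - toH0 (a j)) x := fun i j => by
    refine sigma_smul hγ (fun v => ?_) x
    show ipr ((b i : H) - b j) (w v) = ipr ((a i : H) - a j) v
    rw [h, h, ← map_sub w, ipr_weyl hw]
  have hT : ∀ i, actFun (T (b i)) τ ((⟨w, weyl_mem_G hw⟩ : G) • x) = actFun (T (a i)) τ x :=
    fun i => by
    simp only [actFun, T_eq_conj hw (h i), mul_inv_rev, inv_inv, mul_smul, inv_smul_smul]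
    exact weylInvariant_smul hτ hw _
  have hT' : ∀ i, actFun (T (b i))⁻¹ τ ((⟨w, weyl_mem_G hw⟩ : G) • x) = actFun (T (a i))⁻¹ τ x :=
    fun i => by
    simp only [actFun, T_eq_conj hw (h i), mul_inv_rev, inv_inv, mul_smul, inv_smul_smul]
    exact weylInvariant_smul hτ hw _
  simp only [hirotaLHS, Pi.add_apply, Pi.mul_apply, hadd, hsub, hT, hT']

theorem T_add (a b : halfQE8) : T (a + b) = T a * T b :=
  Subtype.ext (kac_mul ⟨a, halfQE8_le_H0 a.2⟩ ⟨b, halfQE8_le_H0 b.2⟩).symm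

theorem T_neg (a : halfQE8) : T (-a) = (T a)⁻¹ :=
  Subtype.ext (kac_neg ⟨a, halfQE8_le_H0 a.2⟩)

theorem TM_eq_T {u : M} {a : halfQE8} {k : ℂ} (h : (u : H) = e 9 + a + k • c) : TM u = T a :=
  Subtype.ext (kac_eq_of_sub (k := k) (show (u : H) - e 9 = a + k • c by rw [h]; abel))

/-- Up to the translation `T_b`, the pairing with the difference of two points of `M` is the
pairing with the difference of their classical parts. -/
theorem ipr_kac_eq {p q b : H} (hb : b ∈ H0) (hp : p ∈ H0) (hq : q ∈ H0)
    (hpq : ipr p p - ipr q q = 2 * ipr (p - q) b) (v : H) :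
    ipr (p - q) (kac ⟨b, hb⟩ v)
      = ipr ((e 9 + p + ((1 / 2 : ℂ) * ipr p p) • c)
          - (e 9 + q + ((1 / 2 : ℂ) * ipr q q) • c)) v := by
  have hpc : ipr (p - q) c = 0 := by
    rw [ipr_comm]
    exact mem_H0.1 (sub_mem hp hq)
  have e1 : (e 9 + p + ((1 / 2 : ℂ) * ipr p p) • c) - (e 9 + q + ((1 / 2 : ℂ) * ipr q q) • c)
      = (p - q) + (ipr (p - q) b) • c := by
    have : ipr (p - q) b = (1 / 2 : ℂ) * ipr p p - (1 / 2 : ℂ) * ipr q q := by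
      linear_combination -hpq / 2
    rw [this, sub_smul]
    abel
  rw [e1, kac_apply]
  simp only [map_sub (ipr (p - q)), map_add (ipr (p - q)), map_smul (ipr (p - q)), hpc,
    map_add ipr, map_smul ipr, LinearMap.add_apply, LinearMap.smul_apply, smul_eq_mul]
  ring

/-- The sextuple relation at `x` is the Hirota equation at the translate `T_b x`, where the
classical parts of the points `u_i`, `u_i'` are `b ± a_i`. -/
theorem sextupleLHS_eq_hirotaLHS {br : ℂ → ℂ} {γ : X → Hbar} (hγ : IsEquivariant γ) (τ : X → ℂ)
    {u u' : Fin 3 → M} {a : Fin 3 → halfQE8} {b : halfQE8}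
    (ha : ∀ i, ipr (a i : H) (a i) = 1)
    (hu : ∀ i, (u i : H) = e 9 + (b + a i : halfQE8)
      + ((1 / 2 : ℂ) * ipr ((b + a i : halfQE8) : H) (b + a i : halfQE8)) • c)
    (hu' : ∀ i, (u' i : H) = e 9 + (b - a i : halfQE8)
      + ((1 / 2 : ℂ) * ipr ((b - a i : halfQE8) : H) (b - a i : halfQE8)) • c) (x : X) :
    sextupleLHS br γ τ u u' x = hirotaLHS br γ τ a (T b • x) := by
  have hadd : ∀ i j, sigma br γ (toH0 (a i) + toH0 (a j)) (T b • x)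
      = sigma br γ (diffM (u i) (u' j)) x := fun i j => by
    refine sigma_smul hγ (fun v => ?_) x
    have e1 : (a i : H) + a j = (b + a i : halfQE8) - (b - a j : halfQE8) := by
      push_cast
      abel
    show ipr ((a i : H) + a j) (kac _ v) = ipr ((u i : H) - u' j) v
    rw [hu, hu', e1]
    refine ipr_kac_eq _ (halfQE8_le_H0 (b + a i).2) (halfQE8_le_H0 (b - a j).2) ?_ v
    have h1 := ipr_comm (b : H) (a i)
    have h2 := ipr_comm (b : H) (a j)
    push_cast
    simp only [map_add, map_sub, LinearMap.add_apply, LinearMap.sub_apply, h1, h2, ha]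
    ring
  have hsub : ∀ i j, sigma br γ (toH0 (a i) - toH0 (a j)) (T b • x)
      = sigma br γ (diffM (u i) (u j)) x := fun i j => by
    refine sigma_smul hγ (fun v => ?_) x
    have e1 : (a i : H) - a j = (b + a i : halfQE8) - (b + a j : halfQE8) := by
      push_cast
      abel
    show ipr ((a i : H) - a j) (kac _ v) = ipr ((u i : H) - u j) v
    rw [hu, hu, e1]
    refine ipr_kac_eq _ (halfQE8_le_H0 (b + a i).2) (halfQE8_le_H0 (b + a j).2) ?_ v
    have h1 := ipr_comm (b : H) (a i)
    have h2 := ipr_comm (b : H) (a j)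
    push_cast
    simp only [map_add, map_sub, LinearMap.add_apply, LinearMap.sub_apply, h1, h2, ha]
    ring
  have hT' : ∀ i, actFun (T (a i))⁻¹ τ (T b • x) = latticeTau τ (u i) x := fun i => by
    simp only [actFun, latticeTau, inv_inv, TM_eq_T (hu i), smul_smul, ← T_add, add_comm]
  have hT : ∀ i, actFun (T (a i)) τ (T b • x) = latticeTau τ (u' i) x := fun i => by
    simp only [actFun, latticeTau, TM_eq_T (hu' i), smul_smul, inv_inv]
    rw [← T_neg, ← T_add, neg_add_eq_sub]
  simp only [hirotaLHS, sextupleLHS, Pi.add_apply, Pi.mul_apply, hadd, hsub, hT, hT']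
  ring

/-- Every sextuple in condition (b) is the translate of a `C₃`-frame: halve the sum and the
differences of the classical parts. -/
theorem exists_frame_of_sextuple {u u' : Fin 3 → M}
    (hsum : ∀ i j, (u i : H) + u' i = u j + u' j)
    (hort : ∀ i j, ipr ((u i : H) - u' i) ((u j : H) - u' j) = if i = j then 4 else 0) :
    ∃ (a : Fin 3 → halfQE8) (b : halfQE8), IsC3Frame a ∧
      ∀ (br : ℂ → ℂ) (γ : X → Hbar), IsEquivariant γ → ∀ (τ : X → ℂ) (x : X),
        sextupleLHS br γ τ u u' x = hirotaLHS br γ τ a (T b • x) := by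
  choose p hp hu using fun i => exists_eq_of_mem_M (u i).2
  choose p' hp' hu' using fun i => exists_eq_of_mem_M (u' i).2
  have hc9 : ipr (e 9) c = -1 := by rw [ipr_comm]; exact ipr_c_e_succ 8
  -- pairing with `e₉` separates the classical part from the multiple of `c`
  have hs : ∀ i, p i + p' i = p 0 + p' 0 := by
    intro i
    have h := hsum i 0
    rw [hu, hu', hu, hu'] at h
    have h' := congrArg (ipr (e 9)) h
    simp only [map_add, map_smul, hc9, ipr_e9_QE8 (hp _), ipr_e9_QE8 (hp' _), smul_eq_mul] at h'
    have h'' : ((1 / 2 : ℂ) * ipr (p i) (p i) + 1 / 2 * ipr (p' i) (p' i)) • c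
        = ((1 / 2 : ℂ) * ipr (p 0) (p 0) + 1 / 2 * ipr (p' 0) (p' 0)) • c := by
      congr 1
      linear_combination -h'
    rw [add_smul, add_smul] at h''
    linear_combination (norm := module) h - h''
  have hhalf : ∀ {q : H}, q ∈ QE8 → (1 / 2 : ℂ) • q ∈ halfQE8 := by
    intro q hq
    show (1 / 2 : ℂ) • q + (1 / 2 : ℂ) • q ∈ QE8
    rwa [← add_smul, add_halves, one_smul]
  let a : Fin 3 → halfQE8 := fun i => ⟨(1 / 2 : ℂ) • (p i - p' i), hhalf (sub_mem (hp i) (hp' i))⟩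
  let b : halfQE8 := ⟨(1 / 2 : ℂ) • (p 0 + p' 0), hhalf (add_mem (hp 0) (hp' 0))⟩
  have hba : ∀ i, ((b + a i : halfQE8) : H) = p i := fun i => by
    show (1 / 2 : ℂ) • (p 0 + p' 0) + (1 / 2 : ℂ) • (p i - p' i) = p i
    rw [← hs i]
    module
  have hba' : ∀ i, ((b - a i : halfQE8) : H) = p' i := fun i => by
    show (1 / 2 : ℂ) • (p 0 + p' 0) - (1 / 2 : ℂ) • (p i - p' i) = p' i
    rw [← hs i]
    module
  have hort' : ∀ i j, ipr (a i : H) (a j) = if i = j then 1 else 0 := by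
    intro i j
    have hc : ∀ i, ipr c (p i - p' i) = 0 := fun i =>
      mem_H0.1 (QE8_le_H0 (sub_mem (hp i) (hp' i)))
    have hc' : ∀ i, ipr (p i - p' i) c = 0 := fun i => by rw [ipr_comm, hc]
    have hd : ∀ i, ∃ k : ℂ, (u i : H) - u' i = (p i - p' i) + k • c := fun i =>
      ⟨(1 / 2 : ℂ) * ipr (p i) (p i) - (1 / 2 : ℂ) * ipr (p' i) (p' i), by
        rw [hu, hu', sub_smul]
        abel⟩
    obtain ⟨k, hk⟩ := hd i
    obtain ⟨l, hl⟩ := hd j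
    have h := hort i j
    rw [hk, hl, map_add, map_add ipr, LinearMap.add_apply, LinearMap.add_apply, map_smul ipr,
      LinearMap.smul_apply, LinearMap.smul_apply, map_smul, map_smul, hc, hc', ipr_c_c] at h
    show ipr ((1 / 2 : ℂ) • (p i - p' i)) ((1 / 2 : ℂ) • (p j - p' j)) = _
    rw [map_smul ipr, LinearMap.smul_apply, map_smul, smul_eq_mul, smul_eq_mul]
    simp only [smul_eq_mul, mul_zero, add_zero] at h
    rw [h]
    split_ifs <;> norm_num
  refine ⟨a, b, ⟨hort', fun i j => ?_⟩, fun br γ hγ τ x =>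
    sextupleLHS_eq_hirotaLHS hγ τ (fun i => by rw [hort', if_pos rfl])
      (fun i => by rw [hba, ← hu]) (fun i => by rw [hba', ← hu']) x⟩
  have hadd : (a i : H) + a j = p i - p' j := by
    rw [← hba, ← hba']
    push_cast
    abel
  have hsub : (a i : H) - a j = p i - p j := by
    rw [← hba, ← hba]
    push_cast
    abel
  have h1 : (a i : H) + a j ∈ QE8 := hadd ▸ sub_mem (hp i) (hp' j)
  have h2 : (a i : H) - a j ∈ QE8 := hsub ▸ sub_mem (hp i) (hp j)
  refine ⟨h1, h2, ?_, ?_⟩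
  · rw [show -(a i : H) + a j = -((a i : H) - a j) by abel]
    exact neg_mem h2
  · rw [show -(a i : H) - a j = -((a i : H) + a j) by abel]
    exact neg_mem h1

end Functions

/-! ### Oddness of the bracket -/

/-- A bracket is an odd function. -/
theorem IsBracket.neg {br : ℂ → ℂ} (h : IsBracket br) (t : ℂ) : br (-t) = -br t := by
  by_contra hne
  obtain ⟨w, hw⟩ : ∃ w, br w ≠ 0 := by
    by_contra hcon
    push Not at hcon
    exact h.ne_zero (funext hcon)
  -- the relation with `α = β = (w + t) / 2` and `γ = (w - t) / 2`
  have hmul : ∀ z, br (z + (w + t) / 2) * br (z - (w + t) / 2) = 0 := by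
    intro z
    have h0 : br 0 = 0 := by
      have h1 := h.three_term 0 0 0 0
      simp only [add_zero, sub_zero] at h1
      have h2 : br 0 ^ 4 = 0 := by linear_combination h1 / 3
      exact pow_eq_zero_iff (by norm_num) |>.1 h2
    have h3 := h.three_term z ((w + t) / 2) ((w + t) / 2) ((w - t) / 2)
    rw [show (w + t) / 2 + (w - t) / 2 = w by ring, show (w - t) / 2 + (w + t) / 2 = w by ring,
      show (w + t) / 2 - (w - t) / 2 = t by ring, show (w - t) / 2 - (w + t) / 2 = -t by ring,
      sub_self, h0] at h3
    have h4 : br w * (br t + br (-t)) * (br (z + (w + t) / 2) * br (z - (w + t) / 2)) = 0 := by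
      linear_combination h3
    refine (mul_eq_zero.1 h4).resolve_left (mul_ne_zero hw fun h5 => hne ?_)
    linear_combination h5
  -- the ring of entire functions has no zero divisors
  have han : ∀ s, AnalyticOnNhd ℂ (fun z => br (z + s)) Set.univ := fun s =>
    (Complex.analyticOnNhd_univ_iff_differentiable).2
      (h.differentiable.comp (differentiable_id.add_const s))
  have hz : ∀ s, ¬ ∀ z ∈ Set.univ, br (z + s) = 0 := fun s hs =>
    hw (by simpa using hs (w - s) trivial)
  rcases AnalyticOnNhd.eq_zero_or_eq_zero_of_mul_eq_zero (han ((w + t) / 2)) (han (-((w + t) / 2)))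
    (fun z _ => by simpa [sub_eq_add_neg] using hmul z) isPreconnected_univ with h1 | h1
  · exact hz _ h1
  · exact hz _ h1

/-! ### The nine-point relations and the equivalence -/

section Functions

variable {X : Type*} [MulAction G X]

/-- The nine-point relation for `i, j, k, l` is, up to sign, a sextuple relation. -/
theorem exists_sextuple_of_indices {br : ℂ → ℂ} (hbr : IsBracket br) (γ : X → Hbar) (τ : X → ℂ)
    {i j k l : Fin 9} (hij : i ≠ j) (hik : i ≠ k) (hjk : j ≠ k)
    (hil : i ≠ l) (hjl : j ≠ l) (hkl : k ≠ l) :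
    ∃ u u' : Fin 3 → M, (∀ m n, (u m : H) + u' m = u n + u' n) ∧
      (∀ m n, ipr ((u m : H) - u' m) ((u n : H) - u' n) = if m = n then 4 else 0) ∧
      sigma br γ (e2 j k) * sigma br γ (e3 j k l)
          * latticeTau τ (eM i) * latticeTau τ (lineM i l hil)
        + sigma br γ (e2 k i) * sigma br γ (e3 k i l)
          * latticeTau τ (eM j) * latticeTau τ (lineM j l hjl)
        + sigma br γ (e2 i j) * sigma br γ (e3 i j l)
          * latticeTau τ (eM k) * latticeTau τ (lineM k l hkl) = -sextupleLHS br γ τ u u' := by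
  let v : Fin 3 → Fin 9 := ![i, j, k]
  have hinj : ∀ m n, v m = v n ↔ m = n := by
    intro m n
    fin_cases m <;> fin_cases n <;> simp [v, hij, hik, hjk, hij.symm, hik.symm, hjk.symm]
  have hl : ∀ m, v m ≠ l := by
    intro m
    fin_cases m <;> assumption
  have hsigma : ∀ (m n : Fin 9) (h : n ≠ l),
      sigma br γ (diffM (eM m) (lineM n l h)) = -sigma br γ (e3 m n l) := by
    intro m n h
    have e1 : diffM (eM m) (lineM n l h) = -e3 m n l := by
      refine Subtype.ext ?_
      show e m.succ - (e 0 - e n.succ - e l.succ) = -(e 0 - e m.succ - e n.succ - e l.succ)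
      abel
    funext x
    rw [e1]
    show br (pairBar (-e3 m n l) (γ x)) = -br (pairBar (e3 m n l) (γ x))
    rw [← hbr.neg]
    congr 1
    obtain ⟨v, hv⟩ := Submodule.Quotient.mk_surjective _ (γ x)
    rw [← hv, pairBar_mk, pairBar_mk]
    simp
  refine ⟨fun m => eM (v m), fun m => lineM (v m) l (hl m), ?_, ?_, ?_⟩
  · intro m n
    show e (v m).succ + (e 0 - e (v m).succ - e l.succ)
      = e (v n).succ + (e 0 - e (v n).succ - e l.succ)
    abel
  · intro m n
    show ipr (e (v m).succ - (e 0 - e (v m).succ - e l.succ))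
      (e (v n).succ - (e 0 - e (v n).succ - e l.succ)) = _
    simp only [map_sub, LinearMap.sub_apply, ipr_e, Fin.succ_inj, hinj, Fin.succ_ne_zero,
      (Fin.succ_ne_zero _).symm, hl, (hl _).symm, if_false, if_true]
    split_ifs <;> norm_num
  · show _ = -(sigma br γ (diffM (eM j) (eM k)) * sigma br γ (diffM (eM j) (lineM k l hkl))
          * latticeTau τ (eM i) * latticeTau τ (lineM i l hil)
        + sigma br γ (diffM (eM k) (eM i)) * sigma br γ (diffM (eM k) (lineM i l hil))
          * latticeTau τ (eM j) * latticeTau τ (lineM j l hjl)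
        + sigma br γ (diffM (eM i) (eM j)) * sigma br γ (diffM (eM i) (lineM j l hjl))
          * latticeTau τ (eM k) * latticeTau τ (lineM k l hkl))
    rw [hsigma, hsigma, hsigma,
      show diffM (eM j) (eM k) = e2 j k from rfl, show diffM (eM k) (eM i) = e2 k i from rfl,
      show diffM (eM i) (eM j) = e2 i j from rfl]
    ring

end Functions

end NinePoints
end

/-- For a `W(E₈)`-invariant function `τ` on a set `X` with an action of `T(½ Q(E₈)) ⋊ W(E₈)` and
an equivariant map `γ : X → 𝔥 / ℂ c`, the three systems of equations are equivalent. -/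
theorem mainTheorem9 (br : ℂ → ℂ) (hbr : NinePoints.IsBracket br)
    {X : Type*} [MulAction NinePoints.G X]
    (γ : X → NinePoints.Hbar) (hγ : NinePoints.IsEquivariant γ)
    (τ : X → ℂ) (hτ : NinePoints.IsWeylInvariant τ) :
    List.TFAE [NinePoints.NinePointRelations br γ τ,
      NinePoints.SextupleRelations br γ τ,
      NinePoints.FrameHirota br γ τ] := by
  open NinePoints in
  tfae_have 1 → 3 := by
    intro h a ha
    show hirotaLHS br γ τ a = 0
    -- one nine-point relation gives the Hirota equation of one frame at every point of `X`
    obtain ⟨u, u', hsum, hort, hu⟩ := exists_sextuple_of_indices hbr γ τ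
      (i := 0) (j := 1) (k := 2) (l := 3)
      (by decide) (by decide) (by decide) (by decide) (by decide) (by decide)
    rw [h 0 1 2 3 (by decide) (by decide) (by decide), zero_eq_neg] at hu
    obtain ⟨a₀, b, ha₀, hab⟩ := exists_frame_of_sextuple (X := X) hsum hort
    obtain ⟨w, hw, hwa⟩ := exists_weyl_frame ha₀ ha
    funext x
    rw [← smul_inv_smul (⟨w, weyl_mem_G hw⟩ : G) x, hirotaLHS_weyl hγ hτ hw hwa,
      ← smul_inv_smul (T b) ((⟨w, weyl_mem_G hw⟩ : G)⁻¹ • x), ← hab br γ hγ τ, hu]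
    rfl
  tfae_have 3 → 2 := by
    intro h u u' hsum hort
    show sextupleLHS br γ τ u u' = 0
    obtain ⟨a, b, ha, hab⟩ := exists_frame_of_sextuple (X := X) hsum hort
    funext x
    rw [hab br γ hγ τ]
    exact congrFun (h a ha) _
  tfae_have 2 → 1 := by
    intro h i j k l hij hik hjk hil hjl hkl
    obtain ⟨u, u', hsum, hort, hu⟩ :=
      exists_sextuple_of_indices hbr γ τ hij hik hjk hil hjl hkl
    rw [hu, neg_eq_zero]
    exact h u u' hsum hort
  tfae_finish
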